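/- **Theorem 3.7 (radius of convexity of $\mathcal M(1)$).** Let $\mathbb D=\{z\in\mathbb C:|z|<1\}$, and let $\mathcal M(1)$ be the class of complex-valued harmonic functions $f$ on $\mathbb D$, normalized by $f(0)=0$ and $f_z(0)=1$, that can be written as $f=h+\overline g$ with $h,g$ analytic in $\mathbb D$, $h(0)=g(0)=0$, and, for all $z\in\mathbb D$, $$g'(z)=z\,h'(z),\qquad h'(z)\neq 0,\qquad \operatorname{Re}\Bigl(1+\frac{z\,h''(z)}{h'(z)}\Bigr)>-\frac12 .$$ Then the radius of convexity of $\mathcal M(1)$ is $2-\sqrt3$; that is, $2-\sqrt 3$ is the largest $\rho\in(0,1]$ such that every $f\in\mathcal M(1)$ maps every disk $\{|z|<r\}$, $0<r\le\rho$, onto a convex domain (a nonempty open convex set). The bound is sharp for a single function: the function $$F(z)=\operatorname{Re}\frac{z}{(1-z)^2}+i\operatorname{Im}\frac{z}{1-z}$$ belongs to $\mathcal M(1)$, and for every $r$ with $2-\sqrt3<r\le 1$ the image $F(\{|z|<r\})$ is not convex. -/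

import Mathlib

open Complex Metric
open scoped ComplexConjugate

noncomputable section

/-- The open unit disk. -/
def unitDisk : Set ℂ := ball (0 : ℂ) 1

/-- The derivative `f_z = (f_x - i f_y) / 2`. -/
def dz (f : ℂ → ℂ) (z : ℂ) : ℂ :=
  (fderiv ℝ f z 1 - I * fderiv ℝ f z I) / 2

/-- Complex-valued harmonic functions `f` in the unit disk with `f 0 = 0` and `f_z 0 = 1`.
Only the values of `f` on the disk matter. -/
def harmonicClass : Set (ℂ → ℂ) :=
  {f | InnerProductSpace.HarmonicOnNhd f unitDisk ∧ f 0 = 0 ∧ dz f 0 = 1}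

/-- The class `M(α)`: functions `f = h + conj g` of the normalized harmonic class, where `h`, `g`
are analytic in the disk and vanish at `0`, such that `g' = α z h'` and
`Re (1 + z h'' / h') > -1/2` in the disk (in particular `h'` has no zero there). -/
def classM (α : ℂ) : Set (ℂ → ℂ) :=
  {f | f ∈ harmonicClass ∧ ∃ h g : ℂ → ℂ,
    DifferentiableOn ℂ h unitDisk ∧ DifferentiableOn ℂ g unitDisk ∧ h 0 = 0 ∧ g 0 = 0 ∧
    (∀ z ∈ unitDisk, f z = h z + conj (g z)) ∧
    ∀ z ∈ unitDisk, deriv g z = α * z * deriv h z ∧ deriv h z ≠ 0 ∧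
      -(1 / 2 : ℝ) < (1 + z * deriv (deriv h) z / deriv h z).re}

/-- A convex domain: a nonempty, open, convex subset of the plane. -/
def IsConvexDomain (U : Set ℂ) : Prop :=
  U.Nonempty ∧ IsOpen U ∧ Convex ℝ U

/-- `ρ` is the radius of convexity of a class `S` of functions on the unit disk: the largest
`ρ ∈ (0, 1]` such that each `f ∈ S` maps each disk `|z| < r`, `0 < r ≤ ρ`, onto a convex domain.
(Convexity of the image of a disk is not inherited by smaller disks for harmonic functions, hence
the quantifier over `r`.) -/
def IsRadiusOfConvexity (S : Set (ℂ → ℂ)) (ρ : ℝ) : Prop :=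
  IsGreatest {ρ : ℝ | 0 < ρ ∧ ρ ≤ 1 ∧
    ∀ f ∈ S, ∀ r : ℝ, 0 < r → r ≤ ρ → IsConvexDomain (f '' ball (0 : ℂ) r)} ρ

/-- The function `F(z) = Re (z / (1 - z)^2) + i Im (z / (1 - z))`. -/
def extremalF (z : ℂ) : ℂ :=
  ((z / (1 - z) ^ 2).re : ℂ) + I * ((z / (1 - z)).im : ℂ)

end

/-! For a direction `n`, `Re (conj n * f)` equals `Re k` with `k` analytic, `k = conj n * h + n * g`
and `k' = h' * (conj n + n z)`. On `|z| = r` the two factors of `k'` give `Re (1 + z k''/k') ≥ (1 -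
2r)/(1 + r) - r/(1 - r) = (1 - 4r + r²)/(1 - r²)`, nonnegative exactly up to `r = 2 - √3`
(`convex_angle_nonneg`). So `k` is convex up to that circle, and with `n` the normal of the image
curve at `f a`, `Re k` is largest at `a` (`re_le_re_of_convex`). This gives a supporting line of the
image at each boundary point, which makes the open image convex (`convex_of_supporting_lines`).

For sharpness, the image under `extremalF` is symmetric in the real axis, so convexity would put the
real part of each image point into the image. Beyond `2 - √3` some image point lies to the left of
all real image points. -/

/-! ### Schwarz bound and logarithms. -/

/-- Schwarz lemma for `(p - 1)/(p + 2)`: this Möbius map takes `Re > -1/2` to the disk and `1` to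
`0`. -/
theorem re_ge_of_neg_half_lt_re {p : ℂ → ℂ} (hp : DifferentiableOn ℂ p (ball 0 1)) (hp0 : p 0 = 1)
    (hre : ∀ z ∈ ball (0 : ℂ) 1, -(1 / 2 : ℝ) < (p z).re) {z : ℂ} (hz : z ∈ ball (0 : ℂ) 1) :
    (1 - 2 * ‖z‖) / (1 + ‖z‖) ≤ (p z).re := by
  have hne : ∀ w ∈ ball (0 : ℂ) 1, p w + 2 ≠ 0 := fun w hw h => by
    have h1 := congrArg Complex.re h
    have h2 := hre w hw
    simp at h1
    linarith
  have hmaps : Set.MapsTo (fun w => (p w - 1) / (p w + 2)) (ball 0 1) (ball 0 1) := by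
    intro w hw
    rw [mem_ball_zero_iff, norm_div, div_lt_one (norm_pos_iff.2 (hne w hw)),
      ← sq_lt_sq₀ (norm_nonneg _) (norm_nonneg _), ← normSq_eq_norm_sq, ← normSq_eq_norm_sq,
      normSq_apply, normSq_apply]
    have := hre w hw
    simp
    nlinarith
  have hd : DifferentiableOn ℂ (fun w => (p w - 1) / (p w + 2)) (ball 0 1) :=
    (hp.sub_const 1).div (hp.add_const 2) hne
  have hz1 : ‖z‖ < 1 := mem_ball_zero_iff.1 hz
  have hs := norm_le_norm_of_mapsTo_ball hd (hmaps.mono_right ball_subset_closedBall)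
    (by simp [hp0]) hz1
  rw [norm_div, div_le_iff₀ (norm_pos_iff.2 (hne z hz)),
    ← sq_le_sq₀ (norm_nonneg _) (by positivity), mul_pow, ← normSq_eq_norm_sq (p z - 1),
    ← normSq_eq_norm_sq (p z + 2), normSq_apply, normSq_apply] at hs
  simp only [sub_re, sub_im, add_re, add_im, one_re, one_im, re_ofNat, im_ofNat, sub_zero,
    add_zero] at hs
  have h0 := norm_nonneg z
  have h1 := hre z hz
  have h2 : ((p z).re - 1) ^ 2 ≤ (‖z‖ * ((p z).re + 2)) ^ 2 := by
    -- The imaginary part only strengthens the squared Schwarz inequality, so it can be dropped.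
    have : 0 ≤ (1 - ‖z‖ ^ 2) * (p z).im ^ 2 := by
      apply mul_nonneg _ (sq_nonneg _)
      nlinarith
    nlinarith
  have h3 := (abs_le_of_sq_le_sq' h2 (by apply mul_nonneg h0; linarith)).1
  rw [div_le_iff₀ (by linarith)]
  linarith

theorem exists_log_of_ne_zero {F : ℂ → ℂ} (hF : DifferentiableOn ℂ F (ball 0 1))
    (hF0 : ∀ z ∈ ball (0 : ℂ) 1, F z ≠ 0) {a : ℂ} (ha : a ∈ ball (0 : ℂ) 1) :
    ∃ L : ℂ → ℂ, L a = 0 ∧ (∀ z ∈ ball (0 : ℂ) 1, HasDerivAt L (deriv F z / F z) z) ∧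
      ∀ z ∈ ball (0 : ℂ) 1, F z = F a * exp (L z) := by
  obtain ⟨L, hLa, hL⟩ := ((hF.deriv isOpen_ball).div hF hF0).isExactOn_ball.with_val_at a 0
  refine ⟨L, hLa, hL, fun z hz => ?_⟩
  have hd : ∀ w ∈ ball (0 : ℂ) 1, HasDerivAt (fun w => F w * exp (-L w)) 0 w := fun w hw => by
    have h1 := ((hF.differentiableAt (isOpen_ball.mem_nhds hw)).hasDerivAt).mul (hL w hw).neg.cexp
    have h2 := hF0 w hw
    refine h1.congr_deriv ?_
    rw [Pi.div_apply, mul_left_comm, mul_neg, mul_div_cancel₀ _ h2]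
    ring
  have := isOpen_ball.is_const_of_deriv_eq_zero (convex_ball (0 : ℂ) 1).isPreconnected
    (fun w hw => (hd w hw).differentiableAt.differentiableWithinAt)
    (fun w hw => (hd w hw).deriv) hz ha
  simp only [hLa, neg_zero, exp_zero, mul_one] at this
  rw [← this, mul_assoc, ← exp_add]
  simp

/-! ### Supporting lines of convex curves. -/

/-- For a closed curve whose normal angle `φ` makes one monotone turn, the abscissa `u` falls while
`φ ≤ π` and then rises back to its initial value. -/
theorem le_left_of_hasDerivAt_neg_mul_sin {u φ φ' m : ℝ → ℝ} {T : ℝ}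
    (hφ : ∀ t, HasDerivAt φ (φ' t) t) (hφ' : ∀ t, 0 ≤ φ' t) (h0 : φ 0 = 0)
    (hT : φ T = 2 * Real.pi) (hm : ∀ t, 0 ≤ m t)
    (hu : ∀ t, HasDerivAt u (-(m t * Real.sin (φ t))) t) (huT : u T = u 0) {t : ℝ}
    (ht : t ∈ Set.Icc 0 T) : u t ≤ u 0 := by
  have hmono : Monotone φ := monotone_of_hasDerivAt_nonneg hφ hφ'
  rcases le_total (φ t) Real.pi with h | h
  · have : AntitoneOn u (Set.Icc 0 t) := by
      refine antitoneOn_of_hasDerivWithinAt_nonpos (convex_Icc _ _)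
        (fun s _ => (hu s).continuousAt.continuousWithinAt)
        (fun s _ => (hu s).hasDerivWithinAt) fun s hs => ?_
      rw [interior_Icc] at hs
      refine neg_nonpos.2 (mul_nonneg (hm s) (Real.sin_nonneg_of_nonneg_of_le_pi ?_ ?_))
      · rw [← h0]; exact hmono hs.1.le
      · exact (hmono hs.2.le).trans h
    exact this (Set.left_mem_Icc.2 ht.1) (Set.right_mem_Icc.2 ht.1) ht.1
  · have : MonotoneOn u (Set.Icc t T) := by
      refine monotoneOn_of_hasDerivWithinAt_nonneg (convex_Icc _ _)
        (fun s _ => (hu s).continuousAt.continuousWithinAt)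
        (fun s _ => (hu s).hasDerivWithinAt) fun s hs => ?_
      rw [interior_Icc] at hs
      refine neg_nonneg.2 (mul_nonpos_of_nonneg_of_nonpos (hm s) ?_)
      rw [← Real.sin_sub_two_pi]
      refine Real.sin_nonpos_of_nonpos_of_neg_pi_le ?_ ?_
      · have := hmono hs.2.le
        linarith
      · have := hmono hs.1.le
        linarith
    rw [← huT]
    exact this (Set.left_mem_Icc.2 ht.2) (Set.right_mem_Icc.2 ht.2) ht.2

theorem exists_mul_exp_of_norm_eq {z a : ℂ} (ha : a ≠ 0) (h : ‖z‖ = ‖a‖) :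
    ∃ t ∈ Set.Icc 0 (2 * Real.pi), z = a * exp (t * I) := by
  have h1 : ‖z / a‖ = 1 := by rw [norm_div, h, div_self (norm_ne_zero_iff.2 ha)]
  have h2 : exp (arg (z / a) * I) = z / a := by
    have h3 := norm_mul_exp_arg_mul_I (z / a)
    rwa [h1, ofReal_one, one_mul] at h3
  rcases le_total 0 (arg (z / a)) with h3 | h3
  · refine ⟨arg (z / a), ⟨h3, ?_⟩, ?_⟩
    · linarith [arg_le_pi (z / a), Real.pi_pos]
    · rw [h2, mul_div_cancel₀ _ ha]
  · refine ⟨arg (z / a) + 2 * Real.pi, ⟨?_, by linarith⟩, ?_⟩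
    · linarith [neg_pi_lt_arg (z / a), Real.pi_pos]
    · push_cast
      rw [add_mul, exp_add, exp_two_pi_mul_I, mul_one, h2, mul_div_cancel₀ _ ha]

/-- A function that is convex up to the circle through `a` has a supporting line at `a`, and the
direction of that line is determined by the outward derivative. -/
theorem re_le_re_of_convex {k : ℂ → ℂ} {a : ℂ} {c : ℝ} (hk : DifferentiableOn ℂ k (ball 0 1))
    (hk' : ∀ z ∈ ball (0 : ℂ) 1, deriv k z ≠ 0) (ha : ‖a‖ < 1)
    (hconv : ∀ z, ‖z‖ = ‖a‖ → 0 ≤ (1 + z * deriv (deriv k) z / deriv k z).re)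
    (hc : 0 < c) (hac : a * deriv k a = c) {z : ℂ} (hz : z ∈ closedBall (0 : ℂ) ‖a‖) :
    (k z).re ≤ (k a).re := by
  have ha0 : a ≠ 0 := by
    rintro rfl
    rw [zero_mul] at hac
    exact hc.ne (ofReal_eq_zero.1 hac.symm).symm
  have hball : a ∈ ball (0 : ℂ) 1 := by simpa using ha
  obtain ⟨L, hLa, hL, hLk⟩ := exists_log_of_ne_zero (hk.deriv isOpen_ball) hk' hball
  have hγn : ∀ t : ℝ, ‖a * exp (t * I)‖ = ‖a‖ := fun t => by simp [norm_exp_ofReal_mul_I]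
  have hγb : ∀ t : ℝ, a * exp (t * I) ∈ ball (0 : ℂ) 1 := fun t => by
    rw [mem_ball_zero_iff, hγn]; exact ha
  have hγ : ∀ t : ℝ, HasDerivAt (fun s : ℝ => a * exp (s * I)) (a * exp (t * I) * I) t := fun t => by
    have := (((hasDerivAt_id (t : ℂ)).mul_const I).cexp.const_mul a).comp_ofReal
    refine this.congr_deriv ?_
    simp only [id, one_mul, mul_assoc]
  -- On the circle `z k'(z) = c * exp (t I + L z)`, so the normal angle is `t + Im L`. It makes
  -- exactly one turn because `L` is single-valued.
  have hu : ∀ t : ℝ, HasDerivAt (fun s : ℝ => (k (a * exp (s * I))).re)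
      (-(c * Real.exp (L (a * exp (t * I))).re *
        Real.sin (t + (L (a * exp (t * I))).im))) t := fun t => by
    have h1 := ((hk.differentiableAt (isOpen_ball.mem_nhds (hγb t))).hasDerivAt).comp t (hγ t)
    have h2 := reCLM.hasFDerivAt.comp_hasDerivAt t h1
    refine h2.congr_deriv ?_
    rw [hLk _ (hγb t)]
    have : deriv k a * exp (L (a * exp (t * I))) * (a * exp (t * I) * I)
        = c * exp (t * I + L (a * exp (t * I))) * I := by
      rw [exp_add, ← hac]; ring
    rw [this]
    simp [exp_im, mul_assoc]
  have hφ : ∀ t : ℝ, HasDerivAt (fun s : ℝ => s + (L (a * exp (s * I))).im)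
      (1 + a * exp (t * I) * deriv (deriv k) (a * exp (t * I)) / deriv k (a * exp (t * I))).re t :=
    fun t => by
    have h1 := (hL _ (hγb t)).comp t (hγ t)
    have h2 := (hasDerivAt_id t).add (imCLM.hasFDerivAt.comp_hasDerivAt t h1)
    refine h2.congr_deriv ?_
    have : deriv (deriv k) (a * exp (t * I)) / deriv k (a * exp (t * I)) * (a * exp (t * I) * I)
      = a * exp (t * I) * deriv (deriv k) (a * exp (t * I)) / deriv k (a * exp (t * I)) * I := by
      ring
    rw [this]
    simp only [imCLM_apply, mul_I_im, add_re, one_re]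
  have hper : exp ((2 * Real.pi : ℝ) * I) = 1 := by push_cast; exact exp_two_pi_mul_I
  have hcirc : ∀ w, ‖w‖ = ‖a‖ → (k w).re ≤ (k a).re := by
    intro w hw
    obtain ⟨t, ht, rfl⟩ := exists_mul_exp_of_norm_eq ha0 hw
    have := le_left_of_hasDerivAt_neg_mul_sin hφ (fun t => hconv _ (hγn t)) (by simp [hLa])
      (T := 2 * Real.pi) (by rw [hper]; simp [hLa])
      (fun t => mul_nonneg hc.le (Real.exp_pos (L (a * exp (t * I))).re).le) hu
      (by simp only [hper]; simp) ht
    simpa using this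
  have hsub : closedBall (0 : ℂ) ‖a‖ ⊆ ball 0 1 := closedBall_subset_ball ha
  have hpos : ‖a‖ ≠ 0 := norm_ne_zero_iff.2 ha0
  -- Since `|exp k| = exp (Re k)`, the maximum modulus principle carries the bound from the circle
  -- into the disk.
  have hdc : DiffContOnCl ℂ (fun w => exp (k w)) (ball 0 ‖a‖) :=
    DifferentiableOn.diffContOnCl (by
      rw [closure_ball _ hpos]
      exact (hk.mono hsub).cexp)
  have := norm_le_of_forall_mem_frontier_norm_le isBounded_ball hdc (C := ‖exp (k a)‖)
    (fun w hw => by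
      rw [frontier_ball _ hpos, mem_sphere_zero_iff_norm] at hw
      rw [norm_exp, norm_exp]
      exact Real.exp_le_exp.2 (hcirc w hw)) (by rwa [closure_ball _ hpos])
  rw [norm_exp, norm_exp] at this
  exact Real.exp_le_exp.1 this

/-! ### Convexity and openness of planar images. -/

/-- Openness makes the supporting inequalities strict, so the convex hull misses the frontier. Being
connected, it cannot leave `U`. -/
theorem convex_of_supporting_lines {U : Set ℂ} (hU : IsOpen U)
    (h : ∀ w ∈ frontier U, ∃ n : ℂ, n ≠ 0 ∧ ∀ u ∈ U, (conj n * u).re ≤ (conj n * w).re) :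
    Convex ℝ U := by
  rcases U.eq_empty_or_nonempty with rfl | ⟨x, hx⟩
  · exact convex_empty
  have hdisj : ∀ w ∈ frontier U, w ∉ convexHull ℝ U := by
    intro w hw hwU
    obtain ⟨n, hn, hle⟩ := h w hw
    have hlin : IsLinearMap ℝ fun u : ℂ => (conj n * u).re :=
      ⟨fun a b => by simp only [mul_add, add_re], fun c a => by simp [mul_left_comm]⟩
    have hlt : U ⊆ {u | (conj n * u).re < (conj n * w).re} := by
      intro u hu
      have hcont : Filter.Tendsto (fun ε : ℝ => u + ε * n) (nhdsWithin 0 (Set.Ioi 0)) (nhds u) := by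
        have : Continuous fun ε : ℝ => u + ε * n := by fun_prop
        simpa using (this.tendsto 0).mono_left nhdsWithin_le_nhds
      obtain ⟨ε, hεU, hε⟩ :=
        ((hcont.eventually (hU.mem_nhds hu)).and self_mem_nhdsWithin).exists
      have h1 := hle _ hεU
      have h2 : conj n * (u + ε * n) = conj n * u + (ε * normSq n : ℝ) := by
        rw [mul_add, mul_left_comm, ← normSq_eq_conj_mul_self]; push_cast; rfl
      rw [h2, add_re, ofReal_re] at h1
      have := mul_pos (Set.mem_Ioi.1 hε) (normSq_pos.2 hn)
      show (conj n * u).re < (conj n * w).re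
      linarith
    exact lt_irrefl (conj n * w).re (convexHull_min hlt (convex_halfSpace_lt hlin _) hwU)
  have hsub : convexHull ℝ U ⊆ U ∪ (closure U)ᶜ := by
    intro w hw
    by_contra hcon
    rw [Set.mem_union, not_or, Set.mem_compl_iff, not_not] at hcon
    exact hdisj w (by rw [hU.frontier_eq]; exact ⟨hcon.2, hcon.1⟩) hw
  have := (convex_convexHull ℝ U).isPreconnected.subset_left_of_subset_union hU
    isClosed_closure.isOpen_compl
    (Set.disjoint_compl_right_iff_subset.2 subset_closure) hsub
    ⟨x, subset_convexHull ℝ U hx, hx⟩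
  exact (this.antisymm (subset_convexHull ℝ U)) ▸ convex_convexHull ℝ U

theorem hasStrictFDerivAt_add_conj {h g : ℂ → ℂ} {a b z : ℂ} (hh : HasStrictDerivAt h a z)
    (hg : HasStrictDerivAt g b z) :
    ∃ D : ℂ →L[ℝ] ℂ, HasStrictFDerivAt (fun w => h w + conj (g w)) D z ∧
      ∀ v, D v = v * a + conj (v * b) := by
  have h1 := hh.hasStrictFDerivAt.restrictScalars ℝ
  have h2 := (conjCLE : ℂ ≃L[ℝ] ℂ).toContinuousLinearMap.hasStrictFDerivAt.comp z
    (hg.hasStrictFDerivAt.restrictScalars ℝ)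
  exact ⟨_, h1.add h2, fun v => by simp⟩

/-- The real differential `v ↦ v a + conj (v b)` is injective when `|b| < |a|`, hence surjective. -/
theorem map_nhds_add_conj {h g : ℂ → ℂ} {a b z : ℂ} (hh : HasStrictDerivAt h a z)
    (hg : HasStrictDerivAt g b z) (hab : ‖b‖ < ‖a‖) :
    Filter.map (fun w => h w + conj (g w)) (nhds z) = nhds (h z + conj (g z)) := by
  obtain ⟨D, hD, hDv⟩ := hasStrictFDerivAt_add_conj hh hg
  refine hD.map_nhds_eq_of_surj (LinearMap.ker_eq_bot_iff_range_eq_top.1 ?_)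
  rw [LinearMap.ker_eq_bot']
  intro v hv
  have h1 : v * a + conj (v * b) = 0 := by rw [← hDv]; exact hv
  have h2 := congrArg norm (eq_neg_of_add_eq_zero_left h1)
  rw [norm_neg, norm_conj, norm_mul, norm_mul] at h2
  by_contra hne
  exact hab.ne (mul_left_cancel₀ (norm_ne_zero_iff.2 hne) h2).symm

/-! ### Convexity of images for the class `classM 1`. -/

theorem convex_angle_nonneg {h k : ℂ → ℂ} {n z : ℂ} {r : ℝ} (hh : DifferentiableOn ℂ h (ball 0 1))
    (hh' : ∀ w ∈ ball (0 : ℂ) 1, deriv h w ≠ 0)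
    (hre : ∀ w ∈ ball (0 : ℂ) 1, -(1 / 2 : ℝ) < (1 + w * deriv (deriv h) w / deriv h w).re)
    (hn : n ≠ 0) (hk : ∀ w ∈ ball (0 : ℂ) 1, deriv k w = deriv h w * (conj n + n * w))
    (hz : ‖z‖ = r) (hr : r ≤ 2 - √3) :
    0 ≤ (1 + z * deriv (deriv k) z / deriv k z).re := by
  have h3 : (1 : ℝ) < √3 := by rw [Real.lt_sqrt] <;> norm_num
  have hr0 : 0 ≤ r := hz ▸ norm_nonneg z
  have hr1 : r < 1 := by linarith
  have hzb : z ∈ ball (0 : ℂ) 1 := by rw [mem_ball_zero_iff, hz]; exact hr1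
  have hdiff := hh.deriv isOpen_ball
  have hquad : 0 ≤ 1 - 4 * r + r ^ 2 := by
    have := Real.sq_sqrt (show (0 : ℝ) ≤ 3 by norm_num)
    nlinarith
  have hk2 : deriv (deriv k) z = deriv (deriv h) z * (conj n + n * z) + deriv h z * n := by
    have he : deriv k =ᶠ[nhds z] fun w => deriv h w * (conj n + n * w) :=
      Filter.eventuallyEq_of_mem (isOpen_ball.mem_nhds hzb) hk
    rw [he.deriv_eq]
    have h1 := (hdiff.differentiableAt (isOpen_ball.mem_nhds hzb)).hasDerivAt
    have h2 : HasDerivAt (fun w => conj n + n * w) n z := by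
      simpa using ((hasDerivAt_id z).const_mul n).const_add (conj n)
    exact (h1.mul h2).deriv
  have hlow : ‖n‖ * (1 - r) ≤ ‖conj n + n * z‖ := by
    have := norm_sub_le_norm_add (conj n) (n * z)
    rw [norm_conj, norm_mul, hz] at this
    linarith
  have hnpos := norm_pos_iff.2 hn
  have hlpos : 0 < ‖n‖ * (1 - r) := mul_pos hnpos (by linarith)
  have hne : conj n + n * z ≠ 0 := norm_pos_iff.1 (hlpos.trans_le hlow)
  have hsplit : 1 + z * deriv (deriv k) z / deriv k z
      = (1 + z * deriv (deriv h) z / deriv h z) + n * z / (conj n + n * z) := by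
    rw [hk2, hk z hzb]
    have := hh' z hzb
    generalize conj n + n * z = q at hne
    field_simp
    ring
  have hq : -(r / (1 - r)) ≤ (n * z / (conj n + n * z)).re := by
    have h1 := (abs_le.1 (abs_re_le_norm (n * z / (conj n + n * z)))).1
    have h2 : ‖n * z / (conj n + n * z)‖ ≤ r / (1 - r) := by
      rw [norm_div, norm_mul, hz, div_le_div_iff₀ (hlpos.trans_le hlow) (by linarith)]
      nlinarith [mul_le_mul_of_nonneg_left hlow hr0]
    linarith
  have hp := re_ge_of_neg_half_lt_re (p := fun w => 1 + w * deriv (deriv h) w / deriv h w)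
    (((differentiableOn_id.mul (hdiff.deriv isOpen_ball)).div hdiff hh').const_add 1)
    (by simp) hre hzb
  rw [hz] at hp
  have hcomb : r / (1 - r) ≤ (1 - 2 * r) / (1 + r) := by
    rw [div_le_div_iff₀ (by linarith) (by linarith)]
    nlinarith
  rw [hsplit, add_re]
  linarith

theorem isConvexDomain_image_of_mem_classM {f : ℂ → ℂ} (hf : f ∈ classM 1) {r : ℝ} (hr0 : 0 < r)
    (hr : r ≤ 2 - √3) : IsConvexDomain (f '' ball (0 : ℂ) r) := by
  obtain ⟨-, h, g, hh, hg, -, -, hfg, hd⟩ := hf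
  unfold unitDisk at *
  have h3 : (1 : ℝ) < √3 := by rw [Real.lt_sqrt] <;> norm_num
  have hr1 : r < 1 := by linarith
  have hsub : closedBall (0 : ℂ) r ⊆ ball 0 1 := closedBall_subset_ball hr1
  have hh' : ∀ z ∈ ball (0 : ℂ) 1, deriv h z ≠ 0 := fun z hz => (hd z hz).2.1
  have hg' : ∀ z ∈ ball (0 : ℂ) 1, deriv g z = z * deriv h z := fun z hz => by
    simpa using (hd z hz).1
  have hstrict : ∀ {φ : ℂ → ℂ}, DifferentiableOn ℂ φ (ball 0 1) → ∀ z ∈ ball (0 : ℂ) 1,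
      HasStrictDerivAt φ (deriv φ z) z := fun hφ z hz =>
    (hφ.analyticAt (isOpen_ball.mem_nhds hz)).hasStrictDerivAt
  have himg : f '' ball 0 r = (fun w => h w + conj (g w)) '' ball 0 r :=
    Set.image_congr fun z hz => hfg z (hsub (ball_subset_closedBall hz))
  have hopen : IsOpen (f '' ball 0 r) := by
    rw [himg, isOpen_iff_mem_nhds]
    rintro _ ⟨z, hz, rfl⟩
    have hz1 := hsub (ball_subset_closedBall hz)
    have := map_nhds_add_conj (hstrict hh z hz1) (hstrict hg z hz1) (by
      rw [hg' z hz1, norm_mul]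
      exact mul_lt_of_lt_one_left (norm_pos_iff.2 (hh' z hz1)) (mem_ball_zero_iff.1 hz1))
    simp only
    rw [← this]
    exact Filter.image_mem_map (isOpen_ball.mem_nhds hz)
  refine ⟨⟨f 0, 0, mem_ball_self hr0, rfl⟩, hopen, convex_of_supporting_lines hopen ?_⟩
  intro w hw
  rw [hopen.frontier_eq] at hw
  have hfcont : ContinuousOn f (closedBall 0 r) := by
    have h1 : ContinuousOn (fun w => h w + conj (g w)) (closedBall 0 r) :=
      (hh.continuousOn.mono hsub).add
        (continuous_conj.comp_continuousOn (hg.continuousOn.mono hsub))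
    exact h1.congr fun z hz => hfg z (hsub hz)
  have hcl : closure (f '' ball 0 r) ⊆ f '' closedBall 0 r :=
    closure_minimal (Set.image_mono ball_subset_closedBall)
      ((isCompact_closedBall 0 r).image_of_continuousOn hfcont).isClosed
  obtain ⟨a, ha, rfl⟩ := hcl hw.1
  have har : ‖a‖ = r := by
    refine le_antisymm (mem_closedBall_zero_iff.1 ha) (le_of_not_gt fun hlt => ?_)
    exact hw.2 ⟨a, mem_ball_zero_iff.2 hlt, rfl⟩
  have ha1 := hsub ha
  have ha0 : a ≠ 0 := norm_pos_iff.1 (har ▸ hr0)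
  set P := a * deriv h a with hP
  have hP0 : P ≠ 0 := mul_ne_zero ha0 (hh' a ha1)
  have hPlt : ‖a * P‖ < ‖P‖ := by
    rw [norm_mul, har]
    exact mul_lt_of_lt_one_left (norm_pos_iff.2 hP0) hr1
  -- Along `a * exp (t I)` the velocity of `f` at `a` is `I * (P - conj (a * P))`, so this vector is
  -- normal to the image curve.
  have hn : P - conj (a * P) ≠ 0 := by
    intro h0
    have := congrArg norm (sub_eq_zero.1 h0)
    rw [norm_conj] at this
    exact hPlt.ne this.symm
  set n := P - conj (a * P) with hndef
  have hkd : ∀ z ∈ ball (0 : ℂ) 1,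
      HasDerivAt (fun w => conj n * h w + n * g w) (deriv h z * (conj n + n * z)) z := by
    intro z hz
    refine (((hstrict hh z hz).hasDerivAt.const_mul (conj n)).add
      ((hstrict hg z hz).hasDerivAt.const_mul n)).congr_deriv ?_
    rw [hg' z hz]
    ring
  have hk' : ∀ z ∈ ball (0 : ℂ) 1, deriv h z * (conj n + n * z) ≠ 0 := by
    intro z hz
    refine mul_ne_zero (hh' z hz) fun h0 => ?_
    have := congrArg norm (eq_neg_of_add_eq_zero_left h0)
    rw [norm_conj, norm_neg, norm_mul] at this
    have h1 := mul_lt_of_lt_one_right (norm_pos_iff.2 hn) (mem_ball_zero_iff.1 hz)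
    exact h1.ne this.symm
  have hreal : ∀ z ∈ ball (0 : ℂ) 1, (conj n * f z).re = (conj n * h z + n * g z).re := by
    intro z hz
    rw [hfg z hz, mul_add, ← map_mul, add_re, add_re, conj_re]
  refine ⟨n, hn, ?_⟩
  rintro _ ⟨z, hz, rfl⟩
  have hz' := ball_subset_closedBall hz
  rw [hreal z (hsub hz'), hreal a ha1]
  refine re_le_re_of_convex (k := fun w => conj n * h w + n * g w)
    (c := normSq P - normSq (a * P))
    (fun z hz => (hkd z hz).differentiableAt.differentiableWithinAt)
    (fun z hz => by rw [(hkd z hz).deriv]; exact hk' z hz) (har ▸ hr1)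
    (fun z hz => convex_angle_nonneg hh hh' (fun w hw => (hd w hw).2.2) hn
      (fun w hw => (hkd w hw).deriv) (hz.trans har) hr) ?_ ?_ (by rwa [har])
  · rw [sub_pos, normSq_eq_norm_sq, normSq_eq_norm_sq]
    exact pow_lt_pow_left₀ hPlt (norm_nonneg _) two_ne_zero
  -- The cross terms `P * (a * P)` cancel, so `a k'(a) = |P|² - |a P|²` is real.
  · rw [(hkd a ha1).deriv, ← mul_assoc, ← hP, hndef, ofReal_sub, ← mul_conj, ← mul_conj, map_sub,
      conj_conj]
    ring

/-! ### The extremal function and sharpness. -/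

theorem one_sub_ne_zero_of_mem_ball {z : ℂ} (hz : z ∈ ball (0 : ℂ) 1) : 1 - z ≠ 0 := by
  intro h
  rw [← sub_eq_zero.1 h] at hz
  simp at hz

theorem hasDerivAt_extremal_analytic_part {z : ℂ} (hz : z ∈ ball (0 : ℂ) 1) :
    HasDerivAt (fun w : ℂ => (w - w ^ 2 / 2) / (1 - w) ^ 2) (1 / (1 - z) ^ 3) z := by
  have h1 := one_sub_ne_zero_of_mem_ball hz
  have h2 := ((hasDerivAt_id z).sub (((hasDerivAt_id z).pow 2).div_const 2)).div
    (((hasDerivAt_id z).const_sub 1).pow 2) (pow_ne_zero 2 h1)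
  refine h2.congr_deriv ?_
  simp
  field_simp
  ring

theorem hasDerivAt_extremal_coanalytic_part {z : ℂ} (hz : z ∈ ball (0 : ℂ) 1) :
    HasDerivAt (fun w : ℂ => (w ^ 2 / 2) / (1 - w) ^ 2) (z / (1 - z) ^ 3) z := by
  have h1 := one_sub_ne_zero_of_mem_ball hz
  have h2 := (((hasDerivAt_id z).pow 2).div_const 2).div
    (((hasDerivAt_id z).const_sub 1).pow 2) (pow_ne_zero 2 h1)
  refine h2.congr_deriv ?_
  simp
  field_simp
  ring

theorem hasDerivAt_one_div_one_sub_pow_three {z : ℂ} (hz : z ∈ ball (0 : ℂ) 1) :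
    HasDerivAt (fun w : ℂ => 1 / (1 - w) ^ 3) (3 / (1 - z) ^ 4) z := by
  have h1 := one_sub_ne_zero_of_mem_ball hz
  have h2 := (hasDerivAt_const z (1 : ℂ)).div
    (((hasDerivAt_id z).const_sub 1).pow 3) (pow_ne_zero 3 h1)
  refine h2.congr_deriv ?_
  simp
  field_simp

theorem half_lt_re_inv_one_sub {z : ℂ} (hz : z ∈ ball (0 : ℂ) 1) :
    1 / 2 < ((1 - z)⁻¹).re := by
  have h1 := normSq_pos.2 (one_sub_ne_zero_of_mem_ball hz)
  have h2 : normSq z < 1 := by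
    rw [normSq_eq_norm_sq]
    exact pow_lt_one₀ (norm_nonneg _) (mem_ball_zero_iff.1 hz) two_ne_zero
  rw [inv_re, div_lt_div_iff₀ two_pos h1]
  rw [normSq_apply] at *
  simp at *
  nlinarith

theorem extremalF_eq {z : ℂ} (hz : z ∈ ball (0 : ℂ) 1) :
    extremalF z = (z - z ^ 2 / 2) / (1 - z) ^ 2 + conj ((z ^ 2 / 2) / (1 - z) ^ 2) := by
  have h1 := one_sub_ne_zero_of_mem_ball hz
  have e1 : z / (1 - z) ^ 2 = (z - z ^ 2 / 2) / (1 - z) ^ 2 + (z ^ 2 / 2) / (1 - z) ^ 2 := by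
    field_simp
    ring
  have e2 : z / (1 - z) = (z - z ^ 2 / 2) / (1 - z) ^ 2 - (z ^ 2 / 2) / (1 - z) ^ 2 := by
    field_simp
    ring
  rw [extremalF, e1, e2]
  generalize (z - z ^ 2 / 2) / (1 - z) ^ 2 = u
  generalize (z ^ 2 / 2) / (1 - z) ^ 2 = v
  apply Complex.ext <;> simp [sub_eq_add_neg]

theorem extremalF_mem_classM : extremalF ∈ classM 1 := by
  set H : ℂ → ℂ := fun w => (w - w ^ 2 / 2) / (1 - w) ^ 2 with hH
  set G : ℂ → ℂ := fun w => (w ^ 2 / 2) / (1 - w) ^ 2 with hG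
  have hHd : DifferentiableOn ℂ H (ball 0 1) := fun z hz =>
    (hasDerivAt_extremal_analytic_part hz).differentiableAt.differentiableWithinAt
  have hGd : DifferentiableOn ℂ G (ball 0 1) := fun z hz =>
    (hasDerivAt_extremal_coanalytic_part hz).differentiableAt.differentiableWithinAt
  have hnear : ∀ z ∈ ball (0 : ℂ) 1, extremalF =ᶠ[nhds z] fun w => H w + conj (G w) :=
    fun z hz => Filter.eventuallyEq_of_mem (isOpen_ball.mem_nhds hz) fun w hw => extremalF_eq hw
  refine ⟨⟨fun z hz => ?_, by simp [extremalF], ?_⟩, H, G, hHd, hGd, by simp [hH], by simp [hG],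
    fun z hz => extremalF_eq hz, fun z hz => ?_⟩
  · rw [InnerProductSpace.harmonicAt_congr_nhds (hnear z hz)]
    exact (hHd.analyticAt (isOpen_ball.mem_nhds hz)).harmonicAt.add
      (hGd.analyticAt (isOpen_ball.mem_nhds hz)).harmonicAt_conj
  · have h0 : (0 : ℂ) ∈ ball (0 : ℂ) 1 := mem_ball_self one_pos
    obtain ⟨D, hD, hDv⟩ := hasStrictFDerivAt_add_conj
      (hHd.analyticAt (isOpen_ball.mem_nhds h0)).hasStrictDerivAt
      (hGd.analyticAt (isOpen_ball.mem_nhds h0)).hasStrictDerivAt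
    rw [dz, (hnear 0 h0).fderiv_eq, hD.hasFDerivAt.fderiv, hDv, hDv,
      (hasDerivAt_extremal_analytic_part h0).deriv, (hasDerivAt_extremal_coanalytic_part h0).deriv]
    simp
  · have h1 := one_sub_ne_zero_of_mem_ball hz
    have hd1 := (hasDerivAt_extremal_analytic_part hz).deriv
    have hd2 : deriv (deriv H) z = 3 / (1 - z) ^ 4 := by
      have he : deriv H =ᶠ[nhds z] fun w => 1 / (1 - w) ^ 3 :=
        Filter.eventuallyEq_of_mem (isOpen_ball.mem_nhds hz) fun w hw =>
          (hasDerivAt_extremal_analytic_part hw).deriv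
      rw [he.deriv_eq, (hasDerivAt_one_div_one_sub_pow_three hz).deriv]
    rw [hd2, hd1, (hasDerivAt_extremal_coanalytic_part hz).deriv]
    refine ⟨by ring, one_div_ne_zero (pow_ne_zero 3 h1), ?_⟩
    have e : 1 + z * (3 / (1 - z) ^ 4) / (1 / (1 - z) ^ 3) = (3 : ℝ) * (1 - z)⁻¹ - (2 : ℝ) := by
      push_cast
      field_simp
      ring
    have := half_lt_re_inv_one_sub hz
    rw [e, sub_re, re_ofReal_mul, ofReal_re]
    linarith

theorem extremalF_conj (z : ℂ) : extremalF (conj z) = conj (extremalF z) := by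
  have e1 : conj z / (1 - conj z) ^ 2 = conj (z / (1 - z) ^ 2) := by simp
  have e2 : conj z / (1 - conj z) = conj (z / (1 - z)) := by simp
  rw [extremalF, extremalF, e1, e2, conj_re, conj_im]
  simp

theorem extremalF_re (z : ℂ) : (extremalF z).re = (z / (1 - z) ^ 2).re := by
  simp [extremalF]

theorem extremalF_im (z : ℂ) : (extremalF z).im = (z / (1 - z)).im := by
  simp [extremalF]

/-- Points of the disk with real image under `extremalF` are real, and their images are bounded
below by the value at the left end of the diameter. -/
theorem neg_div_le_extremalF_re_of_im_eq_zero {r : ℝ} (hr : r ≤ 1) {z : ℂ} (hz : ‖z‖ < r)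
    (him : (extremalF z).im = 0) : -(r / (1 + r) ^ 2) ≤ (extremalF z).re := by
  have hz1 : z ∈ ball (0 : ℂ) 1 := mem_ball_zero_iff.2 (hz.trans_le hr)
  have h1 := one_sub_ne_zero_of_mem_ball hz1
  have him0 : z.im = 0 := by
    have e : z / (1 - z) = (1 - z)⁻¹ - 1 := by field_simp; ring
    rw [extremalF_im, e, sub_im, inv_im, one_im, sub_zero,
      div_eq_zero_iff, or_iff_left (normSq_pos.2 h1).ne'] at him
    simpa using him
  obtain ⟨x, rfl⟩ : ∃ x : ℝ, z = x := ⟨z.re, Complex.ext (by simp) (by simp [him0])⟩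
  rw [norm_real, Real.norm_eq_abs, abs_lt] at hz
  have e : (x : ℂ) / (1 - x) ^ 2 = ((x / (1 - x) ^ 2 : ℝ) : ℂ) := by push_cast; rfl
  rw [extremalF_re, e, ofReal_re, neg_le_iff_add_nonneg]
  have hr0 : 0 < r := by linarith
  have hx : 0 < 1 - x := by linarith
  have : x / (1 - x) ^ 2 + r / (1 + r) ^ 2
      = (x + r) * (1 + r * x) / ((1 - x) ^ 2 * (1 + r) ^ 2) := by
    field_simp
    ring
  rw [this]
  have : 0 ≤ 1 + r * x := by nlinarith
  have : 0 ≤ x + r := by linarith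
  positivity

theorem exists_extremalF_re_lt {r : ℝ} (hr0 : 2 - √3 < r) (hr : r ≤ 1) :
    ∃ z : ℂ, ‖z‖ < r ∧ (extremalF z).re < -(r / (1 + r) ^ 2) := by
  have hsq := Real.sq_sqrt (show (0 : ℝ) ≤ 3 by norm_num)
  have h3 : √3 < 2 := by rw [Real.sqrt_lt] <;> norm_num
  have h31 : (1 : ℝ) < √3 := by rw [Real.lt_sqrt] <;> norm_num
  have hrpos : 0 < r := by linarith
  -- With `A = r + 1/r` and `c = cos (arg z)`, the real part on `|z| = r` is `(A c - 2)/(A - 2c)²`,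
  -- equal to `-1/(A + 2)` at `c = -1`. For `r ≤ 1`, `A < 4` means `r > 2 - √3`.
  obtain ⟨A, hA⟩ : ∃ A, A = (1 + r ^ 2) / r := ⟨_, rfl⟩
  have hAr : A * r = 1 + r ^ 2 := by rw [hA]; field_simp
  have hA2 : 2 ≤ A := by rw [hA, le_div_iff₀ hrpos]; nlinarith [sq_nonneg (r - 1)]
  have hA4 : A < 4 := by rw [hA, div_lt_iff₀ hrpos]; nlinarith
  -- The value drops below `-1/(A + 2)` exactly for `c` between `-1` and `(4 + 2A - A²)/4`, the
  -- roots of a quadratic; this is their midpoint.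
  set c : ℝ := (2 * A - A ^ 2) / 8 with hc
  have hc1 : -1 < c := by rw [hc]; nlinarith
  have hc2 : c ≤ 0 := by rw [hc]; nlinarith
  set s : ℝ := √(1 - c ^ 2) with hs
  have hs2 : s ^ 2 = 1 - c ^ 2 := Real.sq_sqrt (by nlinarith)
  set z : ℂ := ⟨r * c, r * s⟩ with hz
  have hzn : ‖z‖ = r := by
    rw [← abs_of_pos hrpos, ← abs_of_nonneg (norm_nonneg z), ← sq_eq_sq_iff_abs_eq_abs,
      ← normSq_eq_norm_sq, normSq_apply]
    simp only [hz]
    linear_combination r ^ 2 * hs2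
  have hD : normSq (1 - z) = r * (A - 2 * c) := by
    rw [normSq_apply]
    simp [hz]
    linear_combination r ^ 2 * hs2 - hAr
  have hAc : 0 < A - 2 * c := by linarith
  have hDpos : 0 < normSq (1 - z) := by rw [hD]; positivity
  have hre : (z / (1 - z) ^ 2).re = (A * c - 2) / (A - 2 * c) ^ 2 := by
    have hnum : (z * conj (1 - z) ^ 2).re = r ^ 2 * (A * c - 2) := by
      simp [hz, pow_two]
      linear_combination (r ^ 2 * (r * c - 2)) * hs2 - r * c * hAr
    have e : z / (1 - z) ^ 2 = z * conj (1 - z) ^ 2 * ((normSq (1 - z) ^ 2)⁻¹ : ℝ) := by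
      rw [div_eq_mul_inv, ← inv_pow, inv_def]
      push_cast
      ring
    rw [e, re_mul_ofReal, hnum, hD]
    field_simp
  have hlt : (z / (1 - z) ^ 2).re < -(r / (1 + r) ^ 2) := by
    have e : r / (1 + r) ^ 2 = 1 / (A + 2) := by
      rw [div_eq_div_iff (by positivity) (by positivity)]
      linear_combination hAr
    rw [hre, e, ← neg_div, div_lt_div_iff₀ (by positivity) (by positivity)]
    have : 0 < (1 + c) * (-4 - 4 * c + 2 * A - A ^ 2 + 8) := by
      apply mul_pos <;> nlinarith
    nlinarith
  -- The point `z` lies on the circle itself; continuity moves it into the open disk.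
  have hcont : ContinuousAt (fun w : ℂ => (w / (1 - w) ^ 2).re) z := by
    have : (1 - z) ^ 2 ≠ 0 := pow_ne_zero 2 (normSq_pos.1 hDpos)
    fun_prop (disch := assumption)
  have hcl : z ∈ closure (ball (0 : ℂ) r) := by
    rw [closure_ball _ hrpos.ne', mem_closedBall_zero_iff]; exact hzn.le
  obtain ⟨w, hw, hwb⟩ := mem_closure_iff_nhds.1 hcl _ (hcont.eventually_lt_const hlt)
  exact ⟨w, mem_ball_zero_iff.1 hwb, by rw [extremalF_re]; exact hw⟩

theorem not_convex_extremalF_image {r : ℝ} (hr0 : 2 - √3 < r) (hr : r ≤ 1) :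
    ¬ Convex ℝ (extremalF '' ball (0 : ℂ) r) := by
  intro hconv
  obtain ⟨z, hz, hlt⟩ := exists_extremalF_re_lt hr0 hr
  have hmid : (((extremalF z).re : ℝ) : ℂ) ∈ extremalF '' ball (0 : ℂ) r := by
    have := hconv ⟨z, mem_ball_zero_iff.2 hz, rfl⟩
      ⟨conj z, mem_ball_zero_iff.2 (by rwa [norm_conj]), rfl⟩
      (show (0 : ℝ) ≤ 1 / 2 by norm_num) (show (0 : ℝ) ≤ 1 / 2 by norm_num) (by norm_num)
    rw [extremalF_conj, ← smul_add, add_conj] at this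
    convert this using 1
    rw [real_smul]
    push_cast
    ring
  obtain ⟨v, hv, hvz⟩ := hmid
  have := neg_div_le_extremalF_re_of_im_eq_zero hr (mem_ball_zero_iff.1 hv)
    (by rw [hvz, ofReal_im])
  rw [hvz, ofReal_re] at this
  exact absurd hlt this.not_gt

theorem theorem3p7 :
    IsRadiusOfConvexity (classM 1) (2 - √3) ∧
    extremalF ∈ classM 1 ∧
    ∀ r : ℝ, 2 - √3 < r → r ≤ 1 → ¬ Convex ℝ (extremalF '' ball (0 : ℂ) r) := by
  refine ⟨⟨⟨?_, ?_, fun f hf r hr0 hr => isConvexDomain_image_of_mem_classM hf hr0 hr⟩, ?_⟩,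
    extremalF_mem_classM, fun r hr0 hr => not_convex_extremalF_image hr0 hr⟩
  · rw [sub_pos, Real.sqrt_lt] <;> norm_num
  · have : (1 : ℝ) < √3 := by rw [Real.lt_sqrt] <;> norm_num
    linarith
  · rintro ρ ⟨hρ0, hρ1, hρ⟩
    by_contra hlt
    exact not_convex_extremalF_image (not_le.1 hlt) hρ1
      (hρ _ extremalF_mem_classM ρ hρ0 le_rfl).2.2
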